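/- Let $A$ be a finite abelian group and let $B$ be a subgroup of $A$ of index $2$. For a subset $S\subseteq A$, let $\mathrm{Cay}(A,S)$ be the digraph with vertex set $A$ in which $(g,h)$ is an arc if and only if $gh^{-1}\in S$. It is called bipartite if its vertex set is the disjoint union of two sets such that every arc has one end in each of them, and it is called a DRR (digraphical regular representation) if its automorphism group is exactly the group of right translations $x\mapsto xa$ with $a\in A$. Then the number of subsets $S$ of $A\setminus B$ such that $\mathrm{Cay}(A,S)$ is a bipartite DRR is at least $$2^{\frac{|A|}{2}}-3\cdot 2^{\frac{3|A|}{8}+(\log_2|A|)^2}.$$ -/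

import Mathlib

namespace Digraph

/-- The automorphism group of a digraph, as a group of permutations of its vertices. -/
def autGroup {V : Type*} (Γ : Digraph V) : Subgroup (Equiv.Perm V) where
  carrier := {σ | ∀ u v : V, Γ.Adj (σ u) (σ v) ↔ Γ.Adj u v}
  one_mem' := fun _ _ => Iff.rfl
  mul_mem' := fun {σ τ} hσ hτ u v => (hσ (τ u) (τ v)).trans (hτ u v)
  inv_mem' := fun {σ} hσ u v => by
    simpa using (hσ (σ⁻¹ u) (σ⁻¹ v)).symm

/-- A digraph is bipartite if its vertex set is the disjoint union of two parts `X` and `Xᶜ` such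
that every arc has one end in each part. -/
def IsBipartite {V : Type*} (Γ : Digraph V) : Prop :=
  ∃ X : Set V, ∀ u v : V, Γ.Adj u v → (u ∈ X ↔ v ∉ X)

end Digraph

/-- The Cayley digraph `Cay(G, S)`: its vertices are the elements of `G`, and `(g, h)` is an arc if
and only if `g * h⁻¹ ∈ S`. -/
def cayleyDigraph {G : Type*} [Group G] (S : Set G) : Digraph G where
  Adj g h := g * h⁻¹ ∈ S

/-- The right regular representation of `G`: the group of permutations `x ↦ x * a` of `G`. -/
def rightRegular (G : Type*) [Group G] : Subgroup (Equiv.Perm G) :=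
  (MulAction.toPermHom Gᵐᵒᵖ G).range

/-- `Cay(G, S)` is a DRR (digraphical regular representation): its automorphism group is `G`, where
`G` is identified with its right regular representation. -/
def IsDRR {G : Type*} [Group G] (S : Set G) : Prop :=
  (cayleyDigraph S).autGroup = rightRegular G

/-!
Every `S ⊆ A \ B` gives a bipartite digraph, with parts `B` and its complement, so it suffices to
bound the number of such `S` for which `Cay(A, S)` is not a DRR. For such an `S`, let `H` be minimal
among the groups of automorphisms that properly contain the group `R ≅ A` of translations, and let
`D` be the stabilizer of `1` in `H`.

* If `R` is normal in `H`, a nonidentity element of `D` is a nonidentity automorphism of the group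
  `A` that preserves `S`.
* Otherwise `R` is maximal and self-normalizing, so two distinct conjugates of `R` intersect in the
  centre of `H`: modulo its centre, `H` is a Frobenius group with abelian complement. A count of the
  elements lying in conjugates of `R` shows that its kernel is `D * Z(H)`
  (`IsFrobeniusFactorization.sup_center_normal`), and this kernel is abelian. Elements of `R` outside
  the centre act on it by conjugation without noncentral fixed points, and from this follows
  `IsFrobeniusFactorization.exists_translation`: with `Z < A` corresponding to the centre, some
  `b ∈ Z \ {1}` satisfies `S * b = S` outside `Z`.

In both cases `S` is invariant under an injective map `A → A` whose fixed points form a proper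
subgroup (`invariant_of_not_isDRR`). A proper subgroup has at most `|A| / 4` elements outside `B`, so
the map fixes at most half of the `|A| / 2` elements of `A \ B`, and `ncard_invariant_le` leaves at
most `2 ^ (3 |A| / 8)` invariant sets. An endomorphism of `A` is determined by the images of
`log₂ |A|` generators, and a proper subgroup is generated by `log₂ |A| - 1` elements, so either case
involves at most `|A| ^ log₂ |A|` maps. Hence even the constant `2` would do in place of `3`.
-/

/-! ### Frobenius structure of groups with a maximal self-normalizing abelian subgroup -/

section FrobeniusStructure

/-- A finite group `G` with an abelian, maximal, self-normalizing subgroup `R` and a core-free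
complement `D` of `R`; this is the shape of a permutation group `G` in which the regular abelian
subgroup `R` is maximal but not normal, `D` being a point stabilizer. Modulo its centre, such a
group is a Frobenius group with complement `R`. -/
structure IsFrobeniusFactorization {G : Type*} [Group G] (R D : Subgroup G) : Prop where
  comm : ∀ x ∈ R, ∀ y ∈ R, x * y = y * x
  maximal : ∀ K : Subgroup G, R ≤ K → K = R ∨ K = ⊤
  ne_top : R ≠ ⊤
  self_norm : ∀ g, (∀ x ∈ R, g * x * g⁻¹ ∈ R) → g ∈ R
  disjoint : ∀ x ∈ R, x ∈ D → x = 1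
  exists_mul : ∀ g, ∃ r ∈ R, ∃ d ∈ D, g = r * d
  core_free : ∀ d, (∀ g, g * d * g⁻¹ ∈ D) → d = 1

namespace IsFrobeniusFactorization

open Subgroup

variable {G : Type*} [Group G] {R D : Subgroup G}

/-- Conjugates of `R` by elements outside `R` meet `R` in the centre: the centralizer of a common
element contains two distinct conjugates of the maximal subgroup `R`. -/
lemma mem_center_of_conj_mem (h : IsFrobeniusFactorization R D) {g x : G}
    (hg : g ∉ R) (hx : x ∈ R) (hgx : g * x * g⁻¹ ∈ R) : x ∈ center G := by
  rcases h.maximal (centralizer {x}) (fun y hy => by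
    rw [mem_centralizer_singleton_iff]; exact h.comm y hy x hx) with hC | hC
  · exfalso
    apply hg
    rw [← inv_mem_iff]
    refine h.self_norm _ fun y hy => ?_
    rw [← hC, mem_centralizer_singleton_iff]
    have e := h.comm y hy _ hgx
    calc g⁻¹ * y * g⁻¹⁻¹ * x = g⁻¹ * (y * (g * x * g⁻¹)) * g := by group
      _ = g⁻¹ * ((g * x * g⁻¹) * y) * g := by rw [e]
      _ = x * (g⁻¹ * y * g⁻¹⁻¹) := by group
  · rw [mem_center_iff]
    intro y
    have hy : y ∈ centralizer {x} := hC ▸ mem_top y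
    exact mem_centralizer_singleton_iff.1 hy

lemma center_le (h : IsFrobeniusFactorization R D) : center G ≤ R := fun z hz =>
  h.self_norm z fun x hx => by
    rw [← mem_center_iff.1 hz x]; simpa using hx

lemma exists_not_mem_center (h : IsFrobeniusFactorization R D) : ∃ a ∈ R, a ∉ center G := by
  by_contra! hc
  apply h.ne_top
  rw [eq_top_iff]
  intro g _
  refine h.self_norm g fun x hx => ?_
  rw [mem_center_iff.1 (hc x hx) g]; simpa using hx

/-- `D` meets every conjugate of `R` trivially, as `G = R * D`. -/
lemma eq_one_of_conj_mem (h : IsFrobeniusFactorization R D) {g x : G}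
    (hx : x ∈ D) (hgx : g * x * g⁻¹ ∈ R) : x = 1 := by
  obtain ⟨r, hr, d, hd, rfl⟩ := h.exists_mul g
  have h1 : d * x * d⁻¹ ∈ R := by
    have := R.mul_mem (R.mul_mem (R.inv_mem hr) hgx) hr
    convert this using 1; group
  have := h.disjoint _ h1 (D.mul_mem (D.mul_mem hd hx) (D.inv_mem hd))
  simpa using this

/-- Every element outside `D * Z(G)` is conjugate to a noncentral element of `R`. The map
`(d, r) ↦ d * r` for central `r`, `(d, r) ↦ d * r * d⁻¹` otherwise, is injective on `D × R`, and
`G` has as many elements as `D × R`. -/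
lemma eq_mul_or_eq_conj [Finite G] (h : IsFrobeniusFactorization R D) (g : G) :
    (∃ d ∈ D, ∃ z ∈ center G, g = d * z) ∨
      ∃ d ∈ D, ∃ r ∈ R, r ∉ center G ∧ g = d * r * d⁻¹ := by
  classical
  let Φ : D × R → G := fun p => if (p.2 : G) ∈ center G then p.1 * p.2 else p.1 * p.2 * (p.1 : G)⁻¹
  -- A noncentral conjugate `d * r * d⁻¹` is never of the form `d' * z` with `z` central.
  have key : ∀ d ∈ D, ∀ r ∈ R, r ∉ center G → ∀ d' ∈ D, ∀ z ∈ center G,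
      d * r * d⁻¹ ≠ d' * z := by
    intro d hd r hr hrz d' hd' z hz e
    have e1 : d⁻¹ * d' * d⁻¹⁻¹ = r * z⁻¹ := by
      have hz' := mem_center_iff.1 hz d
      calc d⁻¹ * d' * d⁻¹⁻¹ = d⁻¹ * (d' * z) * z⁻¹ * d := by group
        _ = r * (d⁻¹ * z⁻¹ * d) := by rw [← e]; group
        _ = r * z⁻¹ := by
          have : z⁻¹ * d = d * z⁻¹ := (mem_center_iff.1 ((center G).inv_mem hz) d).symm
          rw [mul_assoc d⁻¹, this]; group
    have h1 := h.eq_one_of_conj_mem (g := d⁻¹) hd'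
      (e1 ▸ R.mul_mem hr (R.inv_mem (h.center_le hz)))
    subst h1
    apply hrz
    have : r = z := by
      rw [← mul_inv_eq_one, ← e1]; group
    rwa [this]
  have hinj : Function.Injective Φ := by
    rintro ⟨⟨d, hd⟩, ⟨r, hr⟩⟩ ⟨⟨d', hd'⟩, ⟨r', hr'⟩⟩ e
    simp only [Φ] at e
    split_ifs at e with h1 h2 h2
    · have e2 : d'⁻¹ * d = r' * r⁻¹ := by
        rw [inv_mul_eq_iff_eq_mul, ← mul_assoc, eq_mul_inv_iff_mul_eq, e]
      have e3 := h.disjoint (d'⁻¹ * d) (e2 ▸ R.mul_mem hr' (R.inv_mem hr))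
        (D.mul_mem (D.inv_mem hd') hd)
      have e4 : d' = d := inv_mul_eq_one.1 e3
      subst e4
      simpa using e
    · exact absurd e.symm (key d' hd' r' hr' h2 d hd r h1)
    · exact absurd e (key d hd r hr h1 d' hd' r' h2)
    · have e1 : d'⁻¹ * d * r * (d'⁻¹ * d)⁻¹ = r' := by
        calc d'⁻¹ * d * r * (d'⁻¹ * d)⁻¹ = d'⁻¹ * (d * r * d⁻¹) * d' := by group
          _ = r' := by rw [e]; group
      have e2 : d'⁻¹ * d ∈ R := by
        by_contra hc
        exact h1 (h.mem_center_of_conj_mem hc hr (e1 ▸ hr'))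
      have e3 := h.disjoint _ e2 (D.mul_mem (D.inv_mem hd') hd)
      have e4 : d' = d := inv_mul_eq_one.1 e3
      subst e4
      simpa using e
  have hcard : Nat.card G ≤ Nat.card (D × R) := by
    refine Nat.card_le_card_of_surjective (fun p : D × R => (p.2 : G) * p.1) fun g => ?_
    obtain ⟨r, hr, d, hd, rfl⟩ := h.exists_mul g
    exact ⟨(⟨d, hd⟩, ⟨r, hr⟩), rfl⟩
  obtain ⟨⟨⟨d, hd⟩, ⟨r, hr⟩⟩, rfl⟩ := (hinj.bijective_of_nat_card_le hcard).2 g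
  by_cases hrz : r ∈ center G
  · exact Or.inl ⟨d, hd, r, hrz, by simp [Φ, hrz]⟩
  · exact Or.inr ⟨d, hd, r, hr, hrz, by simp [Φ, hrz]⟩

lemma mem_sup_center_iff {g : G} :
    g ∈ D ⊔ center G ↔ ∃ d ∈ D, ∃ z ∈ center G, g = d * z := by
  rw [mem_sup_of_normal_right]
  simp only [eq_comm]

/-- The Frobenius kernel: `D * Z(G)` is normal, being the complement of the set of conjugates of
noncentral elements of `R`. -/
lemma sup_center_normal [Finite G] (h : IsFrobeniusFactorization R D) :
    (D ⊔ center G).Normal := by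
  refine ⟨fun n hn g => ?_⟩
  obtain ⟨d, hd, z, hz, rfl⟩ := mem_sup_center_iff.1 hn
  rcases h.eq_mul_or_eq_conj (g * (d * z) * g⁻¹) with H | ⟨d', hd', r, hr, hrz, e⟩
  · exact mem_sup_center_iff.2 H
  · exfalso
    have hz' := fun x => mem_center_iff.1 hz x
    have e1 : (d'⁻¹ * g) * d * (d'⁻¹ * g)⁻¹ = r * z⁻¹ := by
      rw [eq_mul_inv_iff_mul_eq]
      calc d'⁻¹ * g * d * (d'⁻¹ * g)⁻¹ * z = d'⁻¹ * g * d * ((d'⁻¹ * g)⁻¹ * z) := by group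
        _ = d'⁻¹ * (g * (d * z) * g⁻¹) * d' := by rw [hz']; group
        _ = r := by rw [e]; group
    have h1 := h.eq_one_of_conj_mem hd (e1 ▸ R.mul_mem hr (R.inv_mem (h.center_le hz)))
    subst h1
    apply hrz
    have : r = z := by
      rw [← mul_inv_eq_one, ← e1]; group
    rwa [this]

lemma mem_center_of_mem_sup_center (h : IsFrobeniusFactorization R D) {n : G}
    (hn : n ∈ D ⊔ center G) (hR : n ∈ R) : n ∈ center G := by
  obtain ⟨d, hd, z, hz, rfl⟩ := mem_sup_center_iff.1 hn
  have : d ∈ R := (R.mul_mem_cancel_right (h.center_le hz)).1 hR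
  rw [h.disjoint d this hd, one_mul]
  exact hz

/-- The kernel `D * Z(G)` is abelian, since its commutators form a normal set contained in the
core-free subgroup `D`. -/
lemma sup_center_comm [Finite G] (h : IsFrobeniusFactorization R D) {m n : G}
    (hm : m ∈ D ⊔ center G) (hn : n ∈ D ⊔ center G) : m * n = n * m := by
  have key : ∀ m ∈ D ⊔ center G, ∀ n ∈ D ⊔ center G, m * n * m⁻¹ * n⁻¹ ∈ D := by
    intro m hm n hn
    obtain ⟨d, hd, z, hz, rfl⟩ := mem_sup_center_iff.1 hm
    obtain ⟨d', hd', z', hz', rfl⟩ := mem_sup_center_iff.1 hn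
    have hz1 := fun x => mem_center_iff.1 hz x
    have hz2 := fun x => mem_center_iff.1 hz' x
    have : d * z * (d' * z') * (d * z)⁻¹ * (d' * z')⁻¹ = d * d' * d⁻¹ * d'⁻¹ := by
      calc d * z * (d' * z') * (d * z)⁻¹ * (d' * z')⁻¹
          = d * (z * d') * (z' * z⁻¹) * (d⁻¹ * z'⁻¹) * d'⁻¹ := by group
        _ = d * d' * z * (z⁻¹ * z') * (z'⁻¹ * d⁻¹) * d'⁻¹ := by
          rw [← hz1 d', ← hz2 z⁻¹, mem_center_iff.1 ((center G).inv_mem hz') d⁻¹]; group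
        _ = d * d' * d⁻¹ * d'⁻¹ := by group
    rw [this]
    exact D.mul_mem (D.mul_mem (D.mul_mem hd hd') (D.inv_mem hd)) (D.inv_mem hd')
  have h1 : m * n * m⁻¹ * n⁻¹ = 1 := h.core_free _ fun g => by
    have := key _ (h.sup_center_normal.conj_mem m hm g) _ (h.sup_center_normal.conj_mem n hn g)
    convert this using 1; group
  rw [mul_inv_eq_one, mul_inv_eq_iff_eq_mul] at h1
  exact h1

/-- There is a central `q ≠ 1` such that for every noncentral `r ∈ R` the coset `r * D` is moved to
`q * r * D` by some element of `D`. Every noncentral `r ∈ R` induces a bijection `w ↦ r⁻¹ w r w⁻¹` of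
the group `W` of commutators of the abelian kernel with one fixed noncentral element of `R`, and
`W` is not contained in `D`; `q` is the central part of an element of `W`. -/
theorem exists_translation [Finite G] (h : IsFrobeniusFactorization R D) :
    ∃ q ∈ center G, q ≠ 1 ∧
      ∀ r ∈ R, r ∉ center G → ∃ d ∈ D, (q * r)⁻¹ * (d * r) ∈ D := by
  set N := D ⊔ center G with hN
  have : N.Normal := h.sup_center_normal
  let _ : CommGroup N :=
    { (inferInstance : Group N) with
      mul_comm := fun x y => Subtype.ext (h.sup_center_comm x.2 y.2) }
  let c : G → N →* N := fun r => (MulAut.conjNormal r⁻¹ : N ≃* N).toMonoidHom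
  have hc : ∀ r (n : N), (c r n : G) = r⁻¹ * n * r := fun r n => by simp [c]
  let ψ : G → N →* N := fun r => c r / MonoidHom.id N
  have hψ : ∀ r (n : N), (ψ r n : G) = r⁻¹ * n * r * (n : G)⁻¹ := fun r n => by
    have : ψ r n = c r n * n⁻¹ := by simp [ψ, div_eq_mul_inv]
    rw [this, Subgroup.coe_mul, hc]; rfl
  have hcomm : ∀ r ∈ R, ∀ a ∈ R, ∀ n, ψ r (ψ a n) = ψ a (ψ r n) := by
    intro r hr a ha n
    have e : c r (c a n) = c a (c r n) := by
      apply Subtype.ext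
      rw [hc, hc, hc, hc]
      calc r⁻¹ * (a⁻¹ * n * a) * r = (a * r)⁻¹ * n * (a * r) := by group
        _ = (r * a)⁻¹ * n * (r * a) := by rw [h.comm a ha r hr]
        _ = _ := by group
    simp only [ψ, MonoidHom.div_apply, MonoidHom.id_apply, map_div, e]
    exact div_div_div_comm _ _ _ _
  -- If the commutator of `n` with a noncentral element of `R` is central, then `n` is central.
  have hker : ∀ r ∈ R, r ∉ center G → ∀ n : N, (ψ r n : G) ∈ center G → (n : G) ∈ center G := by
    intro r hr hrz n hn
    apply h.mem_center_of_mem_sup_center n.2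
    by_contra hnR
    apply hrz
    refine h.mem_center_of_conj_mem hnR hr ?_
    rw [hψ] at hn
    have e : (n : G) * r * (n : G)⁻¹ = r * (r⁻¹ * n * r * (n : G)⁻¹) := by group
    rw [e]
    exact R.mul_mem hr (h.center_le hn)
  obtain ⟨a, ha, haz⟩ := h.exists_not_mem_center
  -- Commutators with `a` form a normal set, so they do not all lie in the core-free `D`.
  obtain ⟨n₀, hn₀⟩ : ∃ n : N, (ψ a n : G) ∉ D := by
    by_contra! hD
    have hNZ : ∀ n : N, (n : G) ∈ center G := fun n => by
      refine hker a ha haz n ?_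
      have : (ψ a n : G) = 1 := h.core_free _ fun g => by
        obtain ⟨r, hr, d, hd, rfl⟩ := h.exists_mul g
        have hdN : d ∈ N := (le_sup_left : D ≤ N) hd
        have e1 : d * (ψ a n : G) = ψ a n * d := h.sup_center_comm hdN (ψ a n).2
        have e2 : r * d * (ψ a n : G) * (r * d)⁻¹ = c r⁻¹ (ψ a n) := by
          rw [hc, mul_assoc r, e1]; group
        have e3 : c r⁻¹ (ψ a n) = ψ a (c r⁻¹ n) := by
          have := hcomm r⁻¹ (R.inv_mem hr) a ha n
          simp only [ψ, MonoidHom.div_apply, MonoidHom.id_apply, map_div] at this ⊢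
          rw [div_div_div_comm, div_left_inj] at this
          exact this
        rw [e2, e3]
        exact hD _
      rw [this]; exact one_mem _
    apply h.ne_top
    rw [eq_top_iff]
    intro g _
    obtain ⟨r, hr, d, hd, rfl⟩ := h.exists_mul g
    exact R.mul_mem hr (h.center_le (hNZ ⟨d, (le_sup_left : D ≤ N) hd⟩))
  obtain ⟨d₀, hd₀, q, hq, hw⟩ := mem_sup_center_iff.1 (ψ a n₀).2
  refine ⟨q, hq, ?_, fun r hr hrz => ?_⟩
  · rintro rfl
    exact hn₀ (by rw [hw]; simpa using hd₀)
  -- `ψ r` commutes with `ψ a`, so it maps the range of `ψ a` to itself.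
  let f : (ψ a).range → (ψ a).range := fun w => ⟨ψ r w, by
    obtain ⟨w, n, rfl⟩ := w
    exact ⟨ψ r n, (hcomm r hr a ha n).symm⟩⟩
  have hf : Function.Injective f := by
    rintro ⟨_, m, rfl⟩ ⟨_, n, rfl⟩ e
    have e1 : ψ r (ψ a m) = ψ r (ψ a n) := congrArg Subtype.val e
    have e2 : ψ r (ψ a (m / n)) = 1 := by rw [map_div, map_div, e1, div_self']
    have e3 := hker a ha haz _ (hker r hr hrz _ (by rw [e2]; exact one_mem _))
    have e4 : ψ a (m / n) = 1 := by
      apply Subtype.ext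
      rw [hψ, mul_assoc a⁻¹, ← mem_center_iff.1 e3 a]
      simp
    rw [map_div, div_eq_one] at e4
    exact Subtype.ext e4
  obtain ⟨⟨w, _⟩, hw'⟩ := (Finite.injective_iff_surjective.1 hf) ⟨ψ a n₀, n₀, rfl⟩
  have hw1 : (ψ r w : G) = d₀ * q := by rw [← hw]; exact congrArg (fun x => (x.1 : G)) hw'
  obtain ⟨d, hd, z, hz, hdz⟩ := mem_sup_center_iff.1 w.2
  refine ⟨d, hd, ?_⟩
  have hz1 := mem_center_iff.1 hz
  have hq1 := mem_center_iff.1 hq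
  have e : r⁻¹ * d * r * d⁻¹ = d₀ * q := by
    rw [← hw1, hψ, hdz]
    calc r⁻¹ * d * r * d⁻¹ = r⁻¹ * d * (r * z) * z⁻¹ * d⁻¹ := by group
      _ = r⁻¹ * (d * z) * r * (d * z)⁻¹ := by rw [hz1]; group
  have : (q * r)⁻¹ * (d * r) = d₀ * d := by
    calc (q * r)⁻¹ * (d * r) = r⁻¹ * q⁻¹ * (r * (r⁻¹ * d * r * d⁻¹)) * d := by group
      _ = r⁻¹ * q⁻¹ * (r * (d₀ * q)) * d := by rw [e]
      _ = r⁻¹ * q⁻¹ * (r * d₀ * q) * d := by group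
      _ = d₀ * d := by rw [hq1]; group
  rw [this]
  exact D.mul_mem hd₀ hd

end IsFrobeniusFactorization

end FrobeniusStructure

/-! ### Cayley digraphs that are not DRRs -/

section CayleyDigraph

lemma mem_rightRegular_iff {G : Type*} [Group G] {σ : Equiv.Perm G} :
    σ ∈ rightRegular G ↔ ∃ a, ∀ x, σ x = x * a := by
  constructor
  · rintro ⟨a, rfl⟩
    exact ⟨a.unop, fun x => rfl⟩
  · rintro ⟨a, ha⟩
    exact ⟨MulOpposite.op a, Equiv.ext fun x => (ha x).symm⟩

lemma rightRegular_le_autGroup {G : Type*} [Group G] (S : Set G) :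
    rightRegular G ≤ (cayleyDigraph S).autGroup := by
  intro σ hσ
  obtain ⟨a, ha⟩ := mem_rightRegular_iff.1 hσ
  intro u v
  simp [cayleyDigraph, ha]

lemma apply_mem_iff_of_mem_autGroup {G : Type*} [Group G] {S : Set G} {σ : Equiv.Perm G}
    (hσ : σ ∈ (cayleyDigraph S).autGroup) (h1 : σ 1 = 1) (x : G) : σ x ∈ S ↔ x ∈ S := by
  have := hσ x 1
  simpa [cayleyDigraph, h1] using this

/-- Digraphs that are not DRRs are either invariant under a nontrivial group automorphism, or
generalized wreath products: outside a proper subgroup `Z`, the connection set is invariant under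
translation by a nontrivial element of `Z`. -/
theorem invariant_of_not_isDRR {A : Type*} [CommGroup A] [Finite A] {S : Set A} (hS : ¬ IsDRR S) :
    (∃ φ : A →* A, Function.Injective φ ∧ φ ≠ MonoidHom.id A ∧ ∀ x, φ x ∈ S ↔ x ∈ S) ∨
      ∃ Z : Subgroup A, Z ≠ ⊤ ∧ ∃ b ∈ Z, b ≠ 1 ∧ ∀ x, x ∉ Z → (x * b ∈ S ↔ x ∈ S) := by
  have hlt : rightRegular A < (cayleyDigraph S).autGroup :=
    lt_of_le_of_ne (rightRegular_le_autGroup S) (Ne.symm hS)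
  -- `H` covers the group of translations, which is therefore a maximal subgroup of `H`.
  obtain ⟨H, hRH, hH⟩ := exists_covBy_le_of_lt hlt
  set R : Subgroup H := (rightRegular A).subgroupOf H with hR
  set D : Subgroup H := (MulAction.stabilizer (Equiv.Perm A) (1 : A)).subgroupOf H with hD
  have memD : ∀ g : H, g ∈ D ↔ (g : Equiv.Perm A) 1 = 1 := fun g => Iff.rfl
  have memR : ∀ g : H, g ∈ R ↔ ∃ a, ∀ x, (g : Equiv.Perm A) x = x * a := fun g =>
    mem_rightRegular_iff
  let ρ : A → H := fun a => ⟨Equiv.mulRight a, hRH.1.le (mem_rightRegular_iff.2 ⟨a, fun _ => rfl⟩)⟩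
  have hρ : ∀ a x, (ρ a : Equiv.Perm A) x = x * a := fun _ _ => rfl
  have hρR : ∀ a, ρ a ∈ R := fun a => (memR _).2 ⟨a, fun _ => rfl⟩
  have eqρ : ∀ g ∈ R, g = ρ ((g : Equiv.Perm A) 1) := by
    intro g hg
    obtain ⟨a, ha⟩ := (memR g).1 hg
    apply Subtype.ext
    ext x
    rw [hρ, ha, ha, one_mul]
  have hne : R ≠ ⊤ := fun h => hRH.1.not_ge (Subgroup.subgroupOf_eq_top.1 h)
  have exmul : ∀ g : H, ∃ r ∈ R, ∃ d ∈ D, g = r * d := fun g => by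
    refine ⟨ρ ((g : Equiv.Perm A) 1), hρR _, (ρ ((g : Equiv.Perm A) 1))⁻¹ * g, ?_, by group⟩
    rw [memD, Subgroup.coe_mul, Equiv.Perm.mul_apply, Subgroup.coe_inv, Equiv.Perm.inv_eq_iff_eq,
      hρ, one_mul]
  have hmax : ∀ K : Subgroup H, R ≤ K → K = R ∨ K = ⊤ := by
    intro K hK
    have h1 : rightRegular A ≤ K.map H.subtype := by
      intro σ hσ
      exact ⟨⟨σ, hRH.1.le hσ⟩, hK hσ, rfl⟩
    have h2 : K.map H.subtype ≤ H := Subgroup.map_subtype_le K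
    rcases hRH.eq_or_eq h1 h2 with h | h
    · left
      rw [hR, ← h]
      exact (Subgroup.comap_map_eq_self_of_injective H.subtype_injective K).symm
    · right
      rw [eq_top_iff]
      intro g _
      have : (g : Equiv.Perm A) ∈ K.map H.subtype := by rw [h]; exact g.2
      obtain ⟨k, hk, e⟩ := this
      rwa [← H.subtype_injective e]
  by_cases hself : ∀ g, (∀ x ∈ R, g * x * g⁻¹ ∈ R) → g ∈ R
  · right
    have hF : IsFrobeniusFactorization R D :=
      { comm := fun x hx y hy => by
          obtain ⟨a, ha⟩ := (memR x).1 hx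
          obtain ⟨b, hb⟩ := (memR y).1 hy
          apply Subtype.ext
          ext t
          simp [ha, hb, mul_right_comm]
        maximal := hmax
        ne_top := hne
        self_norm := hself
        disjoint := fun x hx hxD => by
          rw [eqρ x hx, (memD x).1 hxD]
          apply Subtype.ext
          ext t
          simp [hρ]
        exists_mul := exmul
        core_free := fun d hd => by
          apply Subtype.ext
          ext x
          have := (memD _).1 (hd (ρ x)⁻¹)
          simp only [Subgroup.coe_mul, Subgroup.coe_inv, inv_inv, Equiv.Perm.mul_apply,
            Equiv.Perm.inv_eq_iff_eq, hρ, one_mul] at this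
          simpa using this }
    obtain ⟨q, hq, hq1, hqd⟩ := hF.exists_translation
    let ρ' : A →* H :=
      { toFun := ρ
        map_one' := Subtype.ext (Equiv.ext fun x => by simp [hρ])
        map_mul' := fun a b => Subtype.ext (Equiv.ext fun x => by
          simp [hρ, mul_comm a b, mul_assoc]) }
    have hqρ := eqρ q (hF.center_le hq)
    refine ⟨(Subgroup.center H).comap ρ', ?_, (q : Equiv.Perm A) 1, ?_, ?_, fun x hx => ?_⟩
    · intro htop
      obtain ⟨a, ha, haz⟩ := hF.exists_not_mem_center
      apply haz
      rw [eqρ a ha]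
      have : (a : Equiv.Perm A) 1 ∈ (Subgroup.center H).comap ρ' := htop ▸ Subgroup.mem_top _
      exact this
    · change ρ ((q : Equiv.Perm A) 1) ∈ Subgroup.center H
      rw [← hqρ]; exact hq
    · intro h1
      apply hq1
      rw [hqρ, h1]
      exact ρ'.map_one
    · obtain ⟨d, hd, hqd⟩ := hqd (ρ x) (hρR x) hx
      have h1 : (d : Equiv.Perm A) x = x * (q : Equiv.Perm A) 1 := by
        rw [memD] at hqd
        simp only [Subgroup.coe_mul, Subgroup.coe_inv, Equiv.Perm.mul_apply,
          Equiv.Perm.inv_eq_iff_eq, hρ, one_mul] at hqd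
        rw [hqd]
        obtain ⟨b, hb⟩ := (memR q).1 (hF.center_le hq)
        rw [hb, hb, one_mul]
      rw [← h1]
      exact apply_mem_iff_of_mem_autGroup (hH d.2) ((memD d).1 hd) x
  -- An element of `D` that normalizes the translations is an automorphism of the group `A`.
  · left
    push Not at hself
    obtain ⟨g, hg, hgR⟩ := hself
    obtain ⟨r, hr, d, hd, rfl⟩ := exmul g
    have hdR : d ∉ R := fun h => hgR (R.mul_mem hr h)
    have hd1 : (d : Equiv.Perm A) 1 = 1 := hd
    have hdn : ∀ x ∈ R, d * x * d⁻¹ ∈ R := fun x hx => by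
      have := R.mul_mem (R.mul_mem (R.inv_mem hr) (hg x hx)) hr
      convert this using 1; group
    have hmul : ∀ x a, (d : Equiv.Perm A) (x * a) =
        (d : Equiv.Perm A) x * (d : Equiv.Perm A) a := by
      intro x a
      obtain ⟨b, hb⟩ := (memR _).1 (hdn (ρ a) (hρR a))
      have hb' : ∀ y, (d : Equiv.Perm A) (y * a) = (d : Equiv.Perm A) y * b := fun y => by
        have := hb ((d : Equiv.Perm A) y)
        simpa [hρ] using this
      have := hb' 1
      rw [hd1, one_mul, one_mul] at this
      rw [hb', this]
    refine ⟨MonoidHom.mk' d hmul, (d : Equiv.Perm A).injective, fun h => hdR ?_,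
      apply_mem_iff_of_mem_autGroup (hH d.2) hd1⟩
    have : d = ρ 1 := by
      apply Subtype.ext
      ext x
      rw [hρ, mul_one]
      exact DFunLike.congr_fun h x
    rw [this]
    exact hρR 1

lemma isBipartite_cayleyDigraph_of_subset {G : Type*} [Group G] {B : Subgroup G}
    (hB : B.index = 2) {S : Set G} (hS : S ⊆ Set.univ \ (B : Set G)) :
    (cayleyDigraph S).IsBipartite := by
  refine ⟨B, fun u v h => ?_⟩
  have h1 : u * v⁻¹ ∉ B := (hS h).2
  rw [Subgroup.mul_mem_iff_of_index_two hB, inv_mem_iff] at h1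
  simp only [SetLike.mem_coe]
  tauto

end CayleyDigraph

/-! ### Counting invariant sets, endomorphisms and subgroups -/

section Counting

/-- If `f` is injective with `m` fixed points in a finite set `T`, then at most `2 ^ ((|T| + m) / 2)`
subsets of `T` are `f`-invariant. A subset `U` of `T` that is minimal among those whose intersection
with an invariant set determines that set contains at most half of the points of `T` which `f`
moves, for `f` sends the moved points of `U` into `T \ U`. -/
theorem ncard_invariant_le {α : Type*} {f : α → α} (hf : Function.Injective f)
    (T : Finset α) {k : ℕ} (hk : T.card + {x ∈ (T : Set α) | f x = x}.ncard ≤ 2 * k + 1) :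
    {S : Set α | S ⊆ T ∧ ∀ x, f x ∈ S ↔ x ∈ S}.ncard ≤ 2 ^ k := by
  classical
  set I := {S : Set α | S ⊆ T ∧ ∀ x, f x ∈ S ↔ x ∈ S} with hI
  have hfix : {x ∈ (T : Set α) | f x = x}.ncard = (T.filter fun x => f x = x).card := by
    rw [← Set.ncard_coe_finset]; congr 1; ext x; simp
  rw [hfix] at hk
  let P : Finset α → Prop := fun U =>
    U ⊆ T ∧ ∀ S ∈ I, ∀ S' ∈ I, (∀ x ∈ U, x ∈ S ↔ x ∈ S') → S = S'
  have hPT : P T := ⟨subset_rfl, fun S hS S' hS' h => Set.ext fun x =>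
    ⟨fun hx => (h x (hS.1 hx)).1 hx, fun hx => (h x (hS'.1 hx)).2 hx⟩⟩
  obtain ⟨U, ⟨hUT, hU⟩, hmin⟩ := WellFounded.has_min
    (r := fun U V : Finset α => U < V) wellFounded_lt {U | P U} ⟨T, hPT⟩
  -- Otherwise `x` could be removed from `U`: either `f x ∉ T`, and then no invariant set contains
  -- `x`, or `f x ∈ U` already decides whether an invariant set contains `x`.
  have hmoved : ∀ x ∈ U, f x ≠ x → f x ∈ T ∧ f x ∉ U := by
    intro x hx hfx
    by_contra hc
    refine hmin (U.erase x) ⟨(Finset.erase_subset x U).trans hUT, fun S hS S' hS' h => ?_⟩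
      (Finset.erase_ssubset hx)
    refine hU S hS S' hS' fun y hy => ?_
    by_cases hyx : y = x
    · subst hyx
      rw [← hS.2 y, ← hS'.2 y]
      by_cases hT : f y ∈ T
      · exact h _ (Finset.mem_erase.2 ⟨hfx, by tauto⟩)
      · exact ⟨fun hy => absurd (hS.1 hy) hT, fun hy => absurd (hS'.1 hy) hT⟩
    · exact h y (Finset.mem_erase.2 ⟨hyx, hy⟩)
  have hcard : (U.filter fun x => f x ≠ x).card ≤ ((T \ U).filter fun x => f x ≠ x).card := by
    refine Finset.card_le_card_of_injOn f (fun x hx => ?_) hf.injOn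
    simp only [Finset.coe_filter, Set.mem_ofPred_eq] at hx
    simp only [Finset.coe_filter, Set.mem_ofPred_eq, Finset.mem_sdiff]
    exact ⟨hmoved x hx.1 hx.2, fun h => hx.2 (hf h)⟩
  have hUk : U.card ≤ k := by
    have h1 := Finset.card_filter_add_card_filter_not (s := U) (fun x => f x = x)
    have h2 := Finset.card_filter_add_card_filter_not (s := T \ U) (fun x => f x = x)
    have h3 := Finset.card_sdiff_add_card_eq_card hUT
    have h4 : (U.filter fun x => f x = x).card ≤ (T.filter fun x => f x = x).card :=
      Finset.card_le_card (Finset.filter_subset_filter _ hUT)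
    simp only [ne_eq] at hcard
    omega
  calc I.ncard ≤ (U.powerset : Set (Finset α)).ncard := by
        refine Set.ncard_le_ncard_of_injOn (fun S => U.filter (· ∈ S)) (fun S _ => ?_) ?_
          (Finset.finite_toSet _)
        · exact Finset.mem_coe.2 (Finset.mem_powerset.2 (Finset.filter_subset _ _))
        · intro S hS S' hS' h
          refine hU S hS S' hS' fun x hx => ?_
          have := congrArg (x ∈ ·) h
          simpa [hx] using this
    _ = 2 ^ U.card := by rw [Set.ncard_coe_finset, Finset.card_powerset]
    _ ≤ 2 ^ k := Nat.pow_le_pow_right two_pos hUk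

variable {G : Type*} [Group G] [Finite G]

lemma two_mul_card_le_of_lt {H K : Subgroup G} (h : H < K) : 2 * Nat.card H ≤ Nat.card K := by
  obtain ⟨c, hc⟩ := Subgroup.card_dvd_of_le h.le
  have hK : 0 < Nat.card K := Nat.card_pos
  have h2 : c ≠ 0 := by rintro rfl; omega
  have h1 : c ≠ 1 := by
    rintro rfl
    exact h.ne (Subgroup.eq_of_le_of_card_ge h.le (by omega))
  rw [hc, mul_comm]
  exact Nat.mul_le_mul_left _ (by omega)

/-- If `F` is not contained in `B`, then half of its elements lie outside `B`. -/
lemma four_mul_ncard_diff_le {B : Subgroup G} (hB : B.index = 2) {F : Subgroup G} (hF : F ≠ ⊤) :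
    4 * ((F : Set G) \ B).ncard ≤ Nat.card G := by
  by_cases hc : ∃ c ∈ F, c ∉ B
  · obtain ⟨c, hcF, hcB⟩ := hc
    have h1 : ((F : Set G) \ B).ncard ≤ ((F : Set G) ∩ B).ncard := by
      refine Set.ncard_le_ncard_of_injOn (· * c) (fun x hx => ⟨F.mul_mem hx.1 hcF, ?_⟩)
        (mul_left_injective c).injOn (Set.toFinite _)
      have hxB : x ∉ B := hx.2
      simp only [SetLike.mem_coe, Subgroup.mul_mem_iff_of_index_two hB]
      tauto
    have h2 := Set.ncard_inter_add_ncard_sdiff_eq_ncard (F : Set G) B (Set.toFinite _)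
    have h3 := two_mul_card_le_of_lt (lt_top_iff_ne_top.2 hF)
    have h4 : Nat.card F = (F : Set G).ncard := rfl
    rw [Subgroup.card_top] at h3
    omega
  · push Not at hc
    rw [Set.sdiff_eq_empty.2 hc]
    simp

/-- Adjoining to `K` elements of `H`, one at a time, at least doubles the order at each step until
`H` is reached. -/
lemma exists_sup_closure_range_eq {k : ℕ} {H K : Subgroup G} (hKH : K ≤ H)
    (hcard : Nat.card H < 2 ^ (k + 1) * Nat.card K) :
    ∃ g : Fin k → G, K ⊔ Subgroup.closure (Set.range g) = H := by
  induction k generalizing K with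
  | zero =>
    refine ⟨1, ?_⟩
    have : K = H := by
      by_contra hne
      have := two_mul_card_le_of_lt (lt_of_le_of_ne hKH hne)
      omega
    simp [this]
  | succ k ih =>
    by_cases hne : K = H
    · refine ⟨1, ?_⟩
      rw [hne, sup_eq_left, Subgroup.closure_le]
      rintro _ ⟨i, rfl⟩
      exact H.one_mem
    · obtain ⟨x, hxH, hxK⟩ := SetLike.exists_of_lt (lt_of_le_of_ne hKH hne)
      have hlt : K < K ⊔ Subgroup.closure {x} := by
        refine lt_of_le_of_ne le_sup_left fun h => hxK ?_
        rw [h]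
        exact (le_sup_right : _ ≤ K ⊔ Subgroup.closure {x})
          (Subgroup.subset_closure rfl)
      have h2 := two_mul_card_le_of_lt hlt
      obtain ⟨g, hg⟩ := ih (K := K ⊔ Subgroup.closure {x})
        (sup_le hKH (by simpa [Subgroup.closure_le] using hxH))
        (lt_of_lt_of_le hcard (by
          calc 2 ^ (k + 1 + 1) * Nat.card K = 2 ^ (k + 1) * (2 * Nat.card K) := by ring
            _ ≤ _ := Nat.mul_le_mul_left _ h2))
      refine ⟨Fin.cons x g, ?_⟩
      rw [Fin.range_cons, Set.insert_eq, Subgroup.closure_union, ← sup_assoc, hg]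

lemma exists_closure_range_eq {k : ℕ} {H : Subgroup G} (hcard : Nat.card H < 2 ^ (k + 1)) :
    ∃ g : Fin k → G, Subgroup.closure (Set.range g) = H := by
  obtain ⟨g, hg⟩ := exists_sup_closure_range_eq (bot_le (a := H)) (by simpa using hcard)
  exact ⟨g, by simpa using hg⟩

lemma card_monoidHom_le :
    Nat.card (G →* G) ≤ Nat.card G ^ Nat.log 2 (Nat.card G) := by
  obtain ⟨g, hg⟩ := exists_closure_range_eq (k := Nat.log 2 (Nat.card G)) (H := (⊤ : Subgroup G))
    (by rw [Subgroup.card_top]; exact Nat.lt_pow_succ_log_self one_lt_two _)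
  have hinj : Function.Injective
      (fun (φ : G →* G) (i : Fin (Nat.log 2 (Nat.card G))) => φ (g i)) := by
    intro φ θ h
    refine MonoidHom.eq_of_eqOn_dense hg ?_
    rintro _ ⟨i, rfl⟩
    exact congrFun h i
  have := Nat.card_le_card_of_injective _ hinj
  rwa [Nat.card_fun, Nat.card_fin] at this

lemma card_proper_subgroup_le :
    Nat.card {Z : Subgroup G // Z ≠ ⊤} ≤ Nat.card G ^ (Nat.log 2 (Nat.card G) - 1) := by
  have hex : ∀ Z : {Z : Subgroup G // Z ≠ ⊤}, ∃ g : Fin (Nat.log 2 (Nat.card G) - 1) → G,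
      Subgroup.closure (Set.range g) = Z.1 := by
    rintro ⟨Z, hZ⟩
    apply exists_closure_range_eq
    have h1 := two_mul_card_le_of_lt (lt_top_iff_ne_top.2 hZ)
    rw [Subgroup.card_top] at h1
    have h2 := Nat.lt_pow_succ_log_self one_lt_two (Nat.card G)
    have h3 : 0 < Nat.card Z := Nat.card_pos
    have h4 : 0 < Nat.log 2 (Nat.card G) := Nat.log_pos one_lt_two (by omega)
    rw [Nat.sub_add_cancel h4]
    rw [pow_succ] at h2
    change Nat.card Z < _
    omega
  choose g hg using hex
  have hinj : Function.Injective g := fun Z Z' h => Subtype.ext (by rw [← hg Z, ← hg Z', h])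
  have := Nat.card_le_card_of_injective _ hinj
  rwa [Nat.card_fun, Nat.card_fin] at this

end Counting

/-! ### The number of bipartite DRRs -/

section Enumeration

variable {A : Type*} [CommGroup A] [Finite A]

lemma two_mul_ncard_compl {B : Subgroup A} (hB : B.index = 2) :
    2 * (Set.univ \ (B : Set A)).ncard = Nat.card A := by
  have h1 := B.card_mul_index
  have h2 := Set.ncard_add_ncard_compl (B : Set A)
  have h4 : Nat.card B = (B : Set A).ncard := rfl
  rw [← Set.compl_eq_univ_sdiff]
  rw [hB] at h1
  omega

lemma ncard_invariant_compl_le {B : Subgroup A} (hB : B.index = 2) {f : A → A}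
    (hf : Function.Injective f) {F : Subgroup A} (hF : F ≠ ⊤) (hfF : ∀ x, f x = x → x ∈ F) :
    {S : Set A | S ⊆ Set.univ \ (B : Set A) ∧ ∀ x, f x ∈ S ↔ x ∈ S}.ncard ≤
      2 ^ (3 * Nat.card A / 8) := by
  have hT := (Set.toFinite (Set.univ \ (B : Set A)))
  have hcoe := hT.coe_toFinset
  have h := ncard_invariant_le hf hT.toFinset (k := 3 * Nat.card A / 8) (by
    rw [← Set.ncard_eq_toFinset_card _ hT, hcoe]
    have h1 := two_mul_ncard_compl hB
    have h2 := four_mul_ncard_diff_le hB hF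
    have h3 : {x ∈ Set.univ \ (B : Set A) | f x = x}.ncard ≤ ((F : Set A) \ B).ncard :=
      Set.ncard_le_ncard (fun x hx => ⟨hfF x hx.2, hx.1.2⟩) (Set.toFinite _)
    omega)
  rwa [hcoe] at h

lemma two_pow_le_ncard_isDRR_add {B : Subgroup A} (hB : B.index = 2) :
    2 ^ (Set.univ \ (B : Set A)).ncard ≤
      {S : Set A | S ⊆ (Set.univ : Set A) \ (B : Set A) ∧
        (cayleyDigraph S).IsBipartite ∧ IsDRR S}.ncard +
      2 * (Nat.card A ^ Nat.log 2 (Nat.card A) * 2 ^ (3 * Nat.card A / 8)) := by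
  classical
  set T := (Set.univ : Set A) \ (B : Set A) with hTdef
  set n := Nat.card A with hn
  set good := {S : Set A | S ⊆ T ∧ (cayleyDigraph S).IsBipartite ∧ IsDRR S} with hgood
  have : Finite (A →* A) := Finite.of_injective _ DFunLike.coe_injective
  let I₁ : (A →* A) → Set (Set A) := fun φ =>
    {S | S ⊆ T ∧ Function.Injective φ ∧ φ ≠ MonoidHom.id A ∧ ∀ x, φ x ∈ S ↔ x ∈ S}
  let I₂ : {Z : Subgroup A // Z ≠ ⊤} × A → Set (Set A) := fun p =>
    {S | S ⊆ T ∧ p.2 ∈ p.1.1 ∧ p.2 ≠ 1 ∧ ∀ x, x ∉ p.1.1 → (x * p.2 ∈ S ↔ x ∈ S)}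
  have hcover : 𝒫 T ⊆ good ∪ ((⋃ φ, I₁ φ) ∪ ⋃ p, I₂ p) := by
    intro S hS
    by_cases hDRR : IsDRR S
    · exact Or.inl ⟨hS, isBipartite_cayleyDigraph_of_subset hB hS, hDRR⟩
    · right
      rcases invariant_of_not_isDRR hDRR with ⟨φ, h⟩ | ⟨Z, hZ, b, h⟩
      · exact Or.inl (Set.mem_iUnion.2 ⟨φ, hS, h⟩)
      · exact Or.inr (Set.mem_iUnion.2 ⟨⟨⟨Z, hZ⟩, b⟩, hS, h⟩)
  have hI₁ : ∀ φ, (I₁ φ).ncard ≤ 2 ^ (3 * n / 8) := by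
    intro φ
    by_cases hφ : Function.Injective φ ∧ φ ≠ MonoidHom.id A
    · have hsub : I₁ φ ⊆ {S | S ⊆ T ∧ ∀ x, φ x ∈ S ↔ x ∈ S} := fun S hS => ⟨hS.1, hS.2.2.2⟩
      refine (Set.ncard_le_ncard hsub (Set.toFinite _)).trans
        (ncard_invariant_compl_le hB hφ.1 (F := φ.eqLocus (MonoidHom.id A)) ?_ fun x hx => hx)
      intro htop
      apply hφ.2
      ext x
      have : x ∈ φ.eqLocus (MonoidHom.id A) := htop ▸ Subgroup.mem_top x
      exact this
    · have : I₁ φ = ∅ := Set.eq_empty_of_forall_notMem fun S hS => hφ ⟨hS.2.1, hS.2.2.1⟩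
      simp [this]
  have hI₂ : ∀ p, (I₂ p).ncard ≤ 2 ^ (3 * n / 8) := by
    rintro ⟨⟨Z, hZ⟩, b⟩
    by_cases hb : b ∈ Z ∧ b ≠ 1
    · let f : A → A := fun x => if x ∈ Z then x else x * b
      have hf : Function.Injective f := by
        intro x y hxy
        have hmem : ∀ x, x * b ∈ Z ↔ x ∈ Z := fun x => Z.mul_mem_cancel_right hb.1
        simp only [f] at hxy
        split_ifs at hxy with hx hy hy
        · exact hxy
        · exact absurd ((hmem y).1 (hxy ▸ hx)) hy
        · exact absurd ((hmem x).1 (hxy ▸ hy)) hx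
        · exact mul_right_cancel hxy
      have hsub : I₂ ⟨⟨Z, hZ⟩, b⟩ ⊆ {S | S ⊆ T ∧ ∀ x, f x ∈ S ↔ x ∈ S} := by
        refine fun S hS => ⟨hS.1, fun x => ?_⟩
        by_cases hx : x ∈ Z
        · simp [f, hx]
        · simpa [f, hx] using hS.2.2.2 x hx
      refine (Set.ncard_le_ncard hsub (Set.toFinite _)).trans
        (ncard_invariant_compl_le hB hf hZ fun x hx => ?_)
      by_contra hxZ
      simp [f, hxZ, hb.2] at hx
    · have : I₂ ⟨⟨Z, hZ⟩, b⟩ = ∅ :=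
        Set.eq_empty_of_forall_notMem fun S hS => hb ⟨hS.2.1, hS.2.2.1⟩
      simp [this]
  have hsum : ∀ {ι : Type _} [Finite ι] (I : ι → Set (Set A)),
      (∀ i, (I i).ncard ≤ 2 ^ (3 * n / 8)) → (⋃ i, I i).ncard ≤ Nat.card ι * 2 ^ (3 * n / 8) := by
    intro ι _ I hI
    have := Fintype.ofFinite ι
    refine (Set.ncard_iUnion_le_of_fintype I).trans ((Finset.sum_le_card_nsmul _ _ _
      fun i _ => hI i).trans ?_)
    simp [Nat.card_eq_fintype_card]
  have hn2 : 2 ≤ n := by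
    have h1 := B.card_mul_index
    have h2 : 0 < Nat.card B := Nat.card_pos
    rw [hB] at h1
    omega
  have hlog : 0 < Nat.log 2 n := Nat.log_pos one_lt_two hn2
  have hpairs : Nat.card ({Z : Subgroup A // Z ≠ ⊤} × A) ≤ n ^ Nat.log 2 n := by
    rw [Nat.card_prod, ← Nat.sub_add_cancel hlog, pow_succ]
    exact Nat.mul_le_mul_right _ card_proper_subgroup_le
  have h1 := (hsum I₁ hI₁).trans (Nat.mul_le_mul_right _ card_monoidHom_le)
  have h2 := (hsum I₂ hI₂).trans (Nat.mul_le_mul_right _ hpairs)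
  have h3 := Set.ncard_le_ncard hcover (Set.toFinite _)
  have h4 := Set.ncard_union_le good ((⋃ φ, I₁ φ) ∪ ⋃ p, I₂ p)
  have h5 := Set.ncard_union_le (⋃ φ, I₁ φ) (⋃ p, I₂ p)
  rw [Set.ncard_powerset T (Set.toFinite _)] at h3
  rw [← hn] at h1
  omega

end Enumeration

theorem theorem1p1 {A : Type*} [CommGroup A] [Finite A] (B : Subgroup A) (hB : B.index = 2) :
    (2 : ℝ) ^ ((Nat.card A : ℝ) / 2)
        - 3 * (2 : ℝ) ^ (3 * (Nat.card A : ℝ) / 8 + (Real.logb 2 (Nat.card A : ℝ)) ^ 2)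
      ≤ (({S : Set A | S ⊆ (Set.univ : Set A) \ (B : Set A) ∧
            (cayleyDigraph S).IsBipartite ∧ IsDRR S}).ncard : ℝ) := by
  have hmain := two_pow_le_ncard_isDRR_add hB
  have hT := two_mul_ncard_compl hB
  have hn : 0 < Nat.card A := Nat.card_pos
  set n := Nat.card A
  have hn0 : (0 : ℝ) < n := by exact_mod_cast hn
  have hn1 : (1 : ℝ) ≤ n := by exact_mod_cast hn
  have e1 : (2 : ℝ) ^ ((n : ℝ) / 2) = (2 : ℝ) ^ (Set.univ \ (B : Set A)).ncard := by
    rw [← Real.rpow_natCast]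
    congr 1
    have : (2 : ℝ) * ((Set.univ \ (B : Set A)).ncard : ℝ) = n := by exact_mod_cast hT
    linarith
  have e2 : ((n : ℝ) ^ Nat.log 2 n) ≤ (2 : ℝ) ^ (Real.logb 2 n ^ 2) := by
    have hlog : ((Nat.log 2 n : ℕ) : ℝ) ≤ Real.logb 2 n := by
      simpa using Real.natLog_le_logb n 2
    calc (n : ℝ) ^ Nat.log 2 n = (n : ℝ) ^ ((Nat.log 2 n : ℕ) : ℝ) := (Real.rpow_natCast _ _).symm
      _ ≤ (n : ℝ) ^ Real.logb 2 n := Real.rpow_le_rpow_of_exponent_le hn1 hlog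
      _ = ((2 : ℝ) ^ Real.logb 2 n) ^ Real.logb 2 n := by
        rw [Real.rpow_logb two_pos (by norm_num) hn0]
      _ = _ := by rw [← Real.rpow_mul two_pos.le, sq]
  have e3 : (2 : ℝ) ^ (3 * n / 8) ≤ (2 : ℝ) ^ (3 * (n : ℝ) / 8) := by
    rw [← Real.rpow_natCast]
    refine Real.rpow_le_rpow_of_exponent_le one_le_two ?_
    have := Nat.cast_div_le (α := ℝ) (m := 3 * n) (n := 8)
    simpa using this
  have e4 : (n : ℝ) ^ Nat.log 2 n * (2 : ℝ) ^ (3 * n / 8) ≤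
      (2 : ℝ) ^ (3 * (n : ℝ) / 8 + Real.logb 2 n ^ 2) := by
    rw [Real.rpow_add two_pos, mul_comm]
    gcongr
  have e5 : (0 : ℝ) ≤ (2 : ℝ) ^ (3 * (n : ℝ) / 8 + Real.logb 2 n ^ 2) := by positivity
  rify at hmain
  rw [e1]
  linarith
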